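/- Let $X$ be a real Banach space with dual $X^*$ that is 2-uniformly convex (its modulus of convexity satisfies $\delta_X(t)\ge Ct^2$ for all $t>0$ and some $C>0$, with $\inf\emptyset=+\infty$) and uniformly smooth ($\rho_X(\tau)/\tau\to0$ as $\tau\downarrow0$, where $\rho_X$ is the modulus of smoothness). Let $J:X\to X^*$ be the (single-valued) normalized duality mapping, $\langle x,Jx\rangle=\|x\|^2=\|Jx\|^2$, and put $\phi(x,y)=\|x\|^2-2\langle x,Jy\rangle+\|y\|^2$. For $\gamma\in\mathbb R$, an operator $T:X\to2^{X^*}$ is called $\gamma$-monotone if $\langle x-y,u-v\rangle\ge\gamma\langle x-y,Jx-Jy\rangle$ whenever $u\in Tx$ and $v\in Ty$; monotone means $0$-monotone, and a monotone operator is maximally monotone if its graph is not properly contained in the graph of a monotone operator. For $r>0$ let $J_r^A=(J+rA)^{-1}J$ be the resolvent of $A$. Then there exists $\mu\ge1$ such that $$\tfrac1\mu\|x-y\|^2\le\phi(x,y)\qquad\text{for all }x,y\in X. \tag{1}$$ Fix any $\mu\ge1$ satisfying (1). Let $A:X\to2^{X^*}$ be maximally monotone and $\alpha$-monotone, and let $B:X\to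 X^*$ be single-valued, $\beta$-monotone and $L$-Lipschitz with $L>0$, where $\alpha,\beta\in\mathbb R$ and $\alpha+\beta>0$. Suppose that the set of zeros $(A+B)^{-1}(0)$ is nonempty. Let $0<\varepsilon<\alpha+\beta$, let $\lambda_n\in\left[\varepsilon,\frac{1-2\varepsilon}{2\mu L}\right]$ for $n\ge0$, let $\lambda_{-1}\in\mathbb R$ and $x_{-1},x_0\in X$, and let $(x_n)$ satisfy $$x_{n+1}=J_{\lambda_n}^A\circ J^{-1}\bigl(Jx_n-\lambda_nBx_n-\lambda_{n-1}(Bx_n-Bx_{n-1})\bigr),\qquad n\ge0.$$ Then $A+B$ has exactly one zero $x^*$, and $(x_n)$ converges strongly to $x^*$ with an R-linear rate, that is, $\|x_n-x^*\|\le Cq^n$ for all $n\ge0$, for some $C\ge 0$ and $q\in[0,1)$. More precisely, there is a constant $\theta>1$, depending only on $\alpha,\beta,\varepsilon$, such that for all $n\ge0$ $$\|x_{n+1}-x^*\|^2\le\frac{2\mu}{\theta^{n}}\,(a_1+b_1),$$ where $a_1=\tfrac12\phi(x^*,x_1)$ and $b_1=\tfrac12\phi(x^*,x_1)+2\lambda_0\langle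 Bx_1-Bx_0,\,x^*-x_1\rangle+\tfrac12\phi(x_1,x_0)$. -/

import Mathlib

open Filter Topology
open scoped NNReal

noncomputable section

namespace FRB

section Space

variable (X : Type*) [NormedAddCommGroup X] [NormedSpace ℝ X]

/-- The modulus of convexity `δ_X`, with values in the extended reals: the infimum of the empty
set (large `t`, or a space of dimension at most one) is `+∞`. -/
def modulusOfConvexity (t : ℝ) : EReal :=
  ⨅ (x : X) (y : X) (_ : ‖x‖ = 1) (_ : ‖y‖ = 1) (_ : ‖x - y‖ = t),
    ((1 - ‖x + y‖ / 2 : ℝ) : EReal)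

/-- `X` is 2-uniformly convex: `δ_X(t) ≥ C t²` for all `t > 0`, for some `C > 0`. -/
def IsTwoUniformlyConvex : Prop :=
  ∃ C : ℝ, 0 < C ∧ ∀ t : ℝ, 0 < t → ((C * t ^ 2 : ℝ) : EReal) ≤ modulusOfConvexity X t

/-- The modulus of smoothness `ρ_X`. The set is bounded above (by `|τ|`). -/
def modulusOfSmoothness (τ : ℝ) : ℝ :=
  sSup {r : ℝ | ∃ x y : X, ‖x‖ = 1 ∧ ‖y‖ = 1 ∧ r = (‖x + τ • y‖ + ‖x - τ • y‖) / 2 - 1}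

/-- `X` is uniformly smooth: `ρ_X(τ) / τ → 0` as `τ → 0`, `τ > 0`. -/
def IsUniformlySmooth : Prop :=
  Tendsto (fun τ : ℝ => modulusOfSmoothness X τ / τ) (𝓝[>] 0) (𝓝 0)

end Space

variable {X : Type*} [NormedAddCommGroup X] [NormedSpace ℝ X]

/-- The value at `x` of the (set-valued) normalized duality mapping. -/
def dualitySet (x : X) : Set (StrongDual ℝ X) :=
  {f | f x = ‖x‖ ^ 2 ∧ ‖f‖ ^ 2 = ‖x‖ ^ 2}

theorem dualitySet_nonempty (x : X) : (dualitySet x).Nonempty := by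
  obtain ⟨g, hg, hgx⟩ := exists_dual_vector'' ℝ x
  by_cases hx : x = 0
  · exact ⟨0, by simp [dualitySet, hx]⟩
  have hx' : 0 < ‖x‖ := norm_pos_iff.mpr hx
  have hgx' : g x = ‖x‖ := by simpa using hgx
  have hg1 : ‖g‖ = 1 := by
    refine le_antisymm hg ?_
    have h1 : ‖x‖ ≤ ‖g‖ * ‖x‖ := by
      have h2 := g.le_opNorm x
      rwa [hgx', norm_norm] at h2
    nlinarith
  refine ⟨‖x‖ • g, ?_, ?_⟩
  · simp [hgx', sq]
  · simp [norm_smul, hg1]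

/-- The normalized duality mapping `J : X → X*` of a smooth space: in a smooth space
`dualitySet x` has exactly one element, and `J x` is that element. -/
def J (x : X) : StrongDual ℝ X :=
  (dualitySet_nonempty x).some

theorem J_mem (x : X) : J x ∈ dualitySet x :=
  (dualitySet_nonempty x).some_mem

theorem le_zero_of_mem_dualitySet (h : IsUniformlySmooth X) {x : X} (hx : x ≠ 0)
    {f g : StrongDual ℝ X} (hf : f ∈ dualitySet x) (hg : g ∈ dualitySet x) {y : X}
    (hy : ‖y‖ = 1) : (f - g) y ≤ 0 := by
  have hx' : 0 < ‖x‖ := norm_pos_iff.mpr hx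
  have norm_eq : ∀ k ∈ dualitySet x, ‖k‖ = ‖x‖ := fun k hk =>
    (sq_eq_sq₀ (norm_nonneg _) (norm_nonneg _)).mp hk.2
  have key : ∀ k ∈ dualitySet x, ∀ t : ℝ, 1 + t * (k y / ‖x‖) ≤ ‖‖x‖⁻¹ • x + t • y‖ := by
    intro k hk t
    have h1 := (le_abs_self _).trans (k.le_opNorm (‖x‖⁻¹ • x + t • y))
    rw [norm_eq k hk, map_add, map_smul, map_smul, hk.1, smul_eq_mul, smul_eq_mul] at h1
    have h2 : ‖x‖ * (1 + t * (k y / ‖x‖)) = ‖x‖⁻¹ * ‖x‖ ^ 2 + t * k y := by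
      field_simp
    exact le_of_mul_le_mul_left (h2.trans_le h1) hx'
  have hu : ‖‖x‖⁻¹ • x‖ = 1 := by
    rw [norm_smul, norm_inv, norm_norm, inv_mul_cancel₀ hx'.ne']
  have hlim : (f - g) y / (2 * ‖x‖) ≤ 0 := by
    refine ge_of_tendsto h ?_
    filter_upwards [self_mem_nhdsWithin] with τ hτ
    have hτ' : 0 < τ := hτ
    rw [le_div_iff₀ hτ']
    have hbdd : BddAbove {r : ℝ | ∃ x y : X, ‖x‖ = 1 ∧ ‖y‖ = 1 ∧
        r = (‖x + τ • y‖ + ‖x - τ • y‖) / 2 - 1} := by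
      refine ⟨τ, ?_⟩
      rintro r ⟨a, b, ha, hb, rfl⟩
      have h1 := norm_add_le a (τ • b)
      have h2 := norm_sub_le a (τ • b)
      rw [norm_smul, ha, hb, Real.norm_of_nonneg hτ'.le] at h1 h2
      linarith
    refine le_trans ?_ (le_csSup hbdd ⟨‖x‖⁻¹ • x, y, hu, hy, rfl⟩)
    have h1 := key f hf τ
    have h2 := key g hg (-τ)
    rw [neg_smul, ← sub_eq_add_neg] at h2
    have h3 : (f - g) y / (2 * ‖x‖) * τ = (τ * (f y / ‖x‖) - τ * (g y / ‖x‖)) / 2 := by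
      rw [sub_apply]
      field_simp
    linarith
  by_contra hcon
  have : 0 < (f - g) y / (2 * ‖x‖) := div_pos (not_le.mp hcon) (by positivity)
  linarith

/-- In a uniformly smooth space the normalized duality mapping is single-valued. -/
theorem dualitySet_eq_singleton (h : IsUniformlySmooth X) (x : X) : dualitySet x = {J x} := by
  refine Set.eq_singleton_iff_unique_mem.mpr ⟨J_mem x, fun f hf => ?_⟩
  by_cases hx : x = 0
  · have h1 := hf.2
    have h2 := (J_mem x).2
    subst hx
    simp only [norm_zero, ne_eq, OfNat.ofNat_ne_zero, not_false_eq_true, zero_pow,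
      pow_eq_zero_iff, norm_eq_zero] at h1 h2
    rw [h1, h2]
  · refine sub_eq_zero.mp (ContinuousLinearMap.ext fun y => ?_)
    by_cases hy : y = 0
    · simp [hy]
    have hy' : 0 < ‖y‖ := norm_pos_iff.mpr hy
    have hu : ‖‖y‖⁻¹ • y‖ = 1 := by
      rw [norm_smul, norm_inv, norm_norm, inv_mul_cancel₀ hy'.ne']
    have h1 := le_zero_of_mem_dualitySet h hx hf (J_mem x) hu
    have h2 := le_zero_of_mem_dualitySet h hx (J_mem x) hf hu
    have h3 : (f - J x) (‖y‖⁻¹ • y) = 0 := by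
      rw [sub_apply] at h1 h2 ⊢
      linarith
    rw [map_smul, smul_eq_mul] at h3
    simpa [hy] using h3

/-- `φ(x, y) = ‖x‖² - 2⟨x, J y⟩ + ‖y‖²`. -/
def phi (x y : X) : ℝ :=
  ‖x‖ ^ 2 - 2 * J y x + ‖y‖ ^ 2

/-- `μ ≥ 1` is a constant with `μ⁻¹ ‖x - y‖² ≤ φ(x, y)` for all `x, y`. -/
def IsPhiConstant (X : Type*) [NormedAddCommGroup X] [NormedSpace ℝ X] (μ : ℝ) : Prop :=
  1 ≤ μ ∧ ∀ x y : X, 1 / μ * ‖x - y‖ ^ 2 ≤ phi x y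

/-- The graph of a set-valued operator `A : X ⇉ X*`. -/
def gra (A : X → Set (StrongDual ℝ X)) : Set (X × StrongDual ℝ X) :=
  {p | p.2 ∈ A p.1}

/-- `α`-monotonicity, measured by the duality mapping:
`⟨x - y, u - v⟩ ≥ α ⟨x - y, J x - J y⟩` for all `(x, u), (y, v)` in the graph. -/
def IsAlphaMonotone (α : ℝ) (A : X → Set (StrongDual ℝ X)) : Prop :=
  ∀ x y : X, ∀ u v : StrongDual ℝ X, (x, u) ∈ gra A → (y, v) ∈ gra A →
    α * (J x - J y) (x - y) ≤ (u - v) (x - y)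

/-- Maximal monotonicity: `A` is monotone (that is, `0`-monotone) and its graph is not properly
contained in the graph of a monotone operator. -/
def IsMaximallyMonotone (A : X → Set (StrongDual ℝ X)) : Prop :=
  IsAlphaMonotone 0 A ∧
    ∀ A' : X → Set (StrongDual ℝ X), IsAlphaMonotone 0 A' → gra A ⊆ gra A' → gra A' = gra A

/-- The set of zeros `(A + B)⁻¹(0)` for a set-valued `A` and a single-valued `B`. -/
def zer (A : X → Set (StrongDual ℝ X)) (B : X → StrongDual ℝ X) : Set X :=
  {x | ∃ u ∈ A x, u + B x = 0}

/-- The resolvent `J_r^A = (J + r A)⁻¹ ∘ J`, as a set-valued mapping: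
`y ∈ J_r^A z` if and only if `J z ∈ J y + r A y`. -/
def resolvent (A : X → Set (StrongDual ℝ X)) (r : ℝ) (z : X) : Set X :=
  {y | ∃ u ∈ A y, J z = J y + r • u}

/-- One step of the forward-reflected-backward method: `xnext` belongs to
`J_r^A (J⁻¹ (J x - r B x - s (B x - B xprev)))`, where `r` is the current and `s` the previous
step size. -/
def IsStep (A : X → Set (StrongDual ℝ X)) (B : X → StrongDual ℝ X) (r s : ℝ)
    (x xprev xnext : X) : Prop :=
  ∃ z : X, J z = J x - r • B x - s • (B x - B xprev) ∧ xnext ∈ resolvent A r z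

/-- `x 0, x 1, …` is generated by the forward-reflected-backward method with step sizes
`s, lam 0, lam 1, …`, where `xprev` and `s` stand for the point and the step size of index `-1`. -/
def IsIteration (A : X → Set (StrongDual ℝ X)) (B : X → StrongDual ℝ X) (s : ℝ) (lam : ℕ → ℝ)
    (xprev : X) (x : ℕ → X) : Prop :=
  IsStep A B (lam 0) s (x 0) xprev (x 1) ∧
    ∀ n : ℕ, IsStep A B (lam (n + 1)) (lam n) (x (n + 1)) (x n) (x (n + 2))

/-- R-linear convergence: the distance to the limit is bounded by a geometric sequence. -/
def ConvergesRLinearly (x : ℕ → X) (p : X) : Prop :=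
  ∃ C q : ℝ, 0 ≤ q ∧ q < 1 ∧ ∀ n : ℕ, ‖x n - p‖ ≤ C * q ^ n

end FRB

end

/-!
The proof combines a geometric estimate with a Lyapunov argument.

*Geometry.* For unit vectors `u`, `v` and a norm-one functional `f` with `f u = 1` one has
`1 + f v ≤ ‖u + v‖ ≤ 2 (1 - C ‖u - v‖²)` by 2-uniform convexity. Rescaled, this reads
`φ(x, y) ≥ (‖x‖ - ‖y‖)² + 4 C ‖x‖ ‖y‖ ‖x/‖x‖ - y/‖y‖‖²`, and the right-hand side dominates a
multiple of `‖x - y‖²` (`exists_isPhiConstant`).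

*Descent.* Let `p` be a zero of `A + B` and put `P n = φ(p, x n)`, `Q n = φ(x n, x (n - 1))` and
`E n = 2 λ_{n-1} ⟨B (x n) - B (x (n - 1)), p - x n⟩`. Applying `α`-monotonicity of `A` and
`β`-monotonicity of `B` at `x (n + 1)` and `p`, and the three-point identity for `φ`, gives
`(1 + ε (α + β)) P (n+1) + (1/2 + ε) Q (n+1) + E (n+1) ≤ P n + E n + (1/2 - ε) Q n`
(`IsStep.descent`); the step-size bound absorbs the inner products involving `B`
(`two_mul_abs_sub_apply_le`). The same bound makes `P + E + Q / 2` comparable with `P` and `Q`, so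
`P n + E n + Q n / 2` (`lyapunov`) decreases by a factor `θ = 1 + min (2 ε (α + β) / 3) ε`, and it
dominates `P n / 2`, hence `‖x n - p‖² / (2 μ)`. All assertions follow, uniqueness of the zero
being a consequence of the strong monotonicity of `A + B`.
-/

namespace FRB

variable {X : Type*} [NormedAddCommGroup X] [NormedSpace ℝ X]

/-! ### The duality mapping and `φ` -/

theorem J_apply_self (x : X) : J x x = ‖x‖ ^ 2 := (J_mem x).1

theorem norm_J (x : X) : ‖J x‖ = ‖x‖ :=
  (sq_eq_sq₀ (norm_nonneg _) (norm_nonneg _)).mp (J_mem x).2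

theorem phi_add_phi_swap (x y : X) : phi x y + phi y x = 2 * (J x - J y) (x - y) := by
  simp only [phi, sub_apply, map_sub, J_apply_self]
  ring

/-- The three-point identity for `φ`. -/
theorem two_mul_J_sub_apply (p x y : X) :
    2 * (J x - J y) (y - p) = phi p x - phi p y - phi y x := by
  simp only [phi, sub_apply, map_sub, J_apply_self]
  ring

theorem phi_nonneg (x y : X) : 0 ≤ phi x y := by
  have h := (le_abs_self _).trans ((J y).le_opNorm x)
  rw [norm_J] at h
  unfold phi
  nlinarith [sq_nonneg (‖x‖ - ‖y‖)]

theorem IsPhiConstant.sq_norm_sub_le {μ : ℝ} (hμ : IsPhiConstant X μ) (x y : X) :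
    ‖x - y‖ ^ 2 ≤ μ * phi x y := by
  have h := hμ.2 x y
  have hpos : 0 < μ := by linarith [hμ.1]
  rwa [one_div, inv_mul_le_iff₀ hpos] at h

/-! ### Uniform convexity -/

theorem norm_add_le_of_le_modulusOfConvexity {E : Type*} [NormedAddCommGroup E] {C : ℝ}
    (hC : ∀ t : ℝ, 0 < t → ((C * t ^ 2 : ℝ) : EReal) ≤ modulusOfConvexity E t)
    {u v : E} (hu : ‖u‖ = 1) (hv : ‖v‖ = 1) : ‖u + v‖ ≤ 2 * (1 - C * ‖u - v‖ ^ 2) := by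
  by_cases h : u = v
  · subst h
    have := norm_add_le u u
    simp only [sub_self, norm_zero]
    linarith
  · have h1 := hC ‖u - v‖ (norm_pos_iff.mpr (sub_ne_zero.mpr h))
    have h2 : modulusOfConvexity E ‖u - v‖ ≤ ((1 - ‖u + v‖ / 2 : ℝ) : EReal) :=
      iInf_le_of_le u (iInf_le_of_le v (iInf_le_of_le hu (iInf_le_of_le hv
        (iInf_le_of_le rfl le_rfl))))
    have h3 := EReal.coe_le_coe_iff.mp (h1.trans h2)
    linarith

theorem le_phi_of_le_modulusOfConvexity {C : ℝ}
    (hC : ∀ t : ℝ, 0 < t → ((C * t ^ 2 : ℝ) : EReal) ≤ modulusOfConvexity X t)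
    {x y : X} (hx : x ≠ 0) (hy : y ≠ 0) :
    (‖x‖ - ‖y‖) ^ 2 + 4 * C * (‖x‖ * ‖y‖) * ‖‖x‖⁻¹ • x - ‖y‖⁻¹ • y‖ ^ 2 ≤ phi x y := by
  have hx' : 0 < ‖x‖ := norm_pos_iff.mpr hx
  have hy' : 0 < ‖y‖ := norm_pos_iff.mpr hy
  have hu : ‖‖x‖⁻¹ • x‖ = 1 := by simp [norm_smul, hx'.ne']
  have hv : ‖‖y‖⁻¹ • y‖ = 1 := by simp [norm_smul, hy'.ne']
  have h1 := norm_add_le_of_le_modulusOfConvexity hC hu hv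
  have h2 := (le_abs_self _).trans ((J y).le_opNorm (‖x‖⁻¹ • x + ‖y‖⁻¹ • y))
  rw [norm_J, map_add, map_smul, map_smul, J_apply_self, smul_eq_mul, smul_eq_mul] at h2
  have h3 := h2.trans (mul_le_mul_of_nonneg_left h1 hy'.le)
  have h4 := mul_le_mul_of_nonneg_left h3 hx'.le
  have h5 : ‖x‖ * (‖x‖⁻¹ * J y x + ‖y‖⁻¹ * ‖y‖ ^ 2) = J y x + ‖x‖ * ‖y‖ := by
    field_simp
  rw [h5] at h4
  unfold phi
  linarith

/-- Splitting `x - y` into a radial and an angular part. -/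
theorem sq_norm_sub_le_radial_add_angular {x y : X} (hx : x ≠ 0) (hy : y ≠ 0) :
    ‖x - y‖ ^ 2 ≤
      2 * (‖x‖ - ‖y‖) ^ 2 + 2 * (‖x‖ * ‖y‖) * ‖‖x‖⁻¹ • x - ‖y‖⁻¹ • y‖ ^ 2 := by
  wlog hle : ‖x‖ ≤ ‖y‖ generalizing x y
  · have h := this hy hx (le_of_not_ge hle)
    rw [norm_sub_rev y x, norm_sub_rev (‖y‖⁻¹ • y)] at h
    linarith
  have hx' : 0 < ‖x‖ := norm_pos_iff.mpr hx
  have hy' : 0 < ‖y‖ := norm_pos_iff.mpr hy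
  set t := ‖‖x‖⁻¹ • x - ‖y‖⁻¹ • y‖
  -- The angular part is scaled by the smaller of the two norms.
  have hdec : x - y = ‖x‖ • (‖x‖⁻¹ • x - ‖y‖⁻¹ • y) + ((‖x‖ - ‖y‖) * ‖y‖⁻¹) • y := by
    have h1 : ((‖x‖ - ‖y‖) * ‖y‖⁻¹) = ‖x‖ * ‖y‖⁻¹ - 1 := by field_simp
    rw [h1, smul_sub, smul_smul, smul_smul, mul_inv_cancel₀ hx'.ne', sub_smul]
    module
  have hn : ‖x - y‖ ≤ ‖x‖ * t + |‖x‖ - ‖y‖| := by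
    calc ‖x - y‖ ≤ _ := (congrArg norm hdec).trans_le (norm_add_le _ _)
      _ = ‖x‖ * t + |‖x‖ - ‖y‖| := by
        rw [norm_smul, norm_smul, norm_norm, norm_mul, norm_inv, norm_norm, Real.norm_eq_abs,
          mul_assoc, inv_mul_cancel₀ hy'.ne', mul_one]
  have hxy : ‖x‖ ^ 2 * t ^ 2 ≤ ‖x‖ * ‖y‖ * t ^ 2 := by
    rw [sq ‖x‖]
    gcongr
  have hsq := pow_le_pow_left₀ (norm_nonneg _) hn 2
  nlinarith [sq_nonneg (‖x‖ * t - |‖x‖ - ‖y‖|), sq_abs (‖x‖ - ‖y‖)]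

theorem exists_isPhiConstant (h : IsTwoUniformlyConvex X) : ∃ μ : ℝ, IsPhiConstant X μ := by
  obtain ⟨C, hC0, hC⟩ := h
  have hμ2 : (2 : ℝ) ≤ max 2 (1 / (2 * C)) := le_max_left _ _
  have hμC : 2 ≤ max 2 (1 / (2 * C)) * (4 * C) := by
    have h1 := mul_le_mul_of_nonneg_right (le_max_right 2 (1 / (2 * C)))
      (by positivity : 0 ≤ 4 * C)
    have h2 : 1 / (2 * C) * (4 * C) = 2 := by field_simp; norm_num
    linarith
  refine ⟨max 2 (1 / (2 * C)), by linarith, fun x y => ?_⟩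
  generalize max 2 (1 / (2 * C)) = μ at hμ2 hμC
  rw [one_div, inv_mul_le_iff₀ (by linarith)]
  by_cases hx : x = 0
  · subst hx
    simp only [phi, zero_sub, norm_neg, norm_zero, map_zero]
    nlinarith [sq_nonneg ‖y‖]
  by_cases hy : y = 0
  · subst hy
    have h0 : J (0 : X) = 0 := norm_eq_zero.mp (by rw [norm_J, norm_zero])
    simp only [phi, sub_zero, norm_zero, h0, zero_apply]
    nlinarith [sq_nonneg ‖x‖]
  have h1 := mul_le_mul_of_nonneg_left (le_phi_of_le_modulusOfConvexity hC hx hy)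
    (by linarith : 0 ≤ μ)
  have h2 := sq_norm_sub_le_radial_add_angular hx hy
  have h3 : 2 * (‖x‖ - ‖y‖) ^ 2 ≤ μ * (‖x‖ - ‖y‖) ^ 2 := by gcongr
  have h4 := mul_le_mul_of_nonneg_right hμC
    (by positivity : 0 ≤ ‖x‖ * ‖y‖ * ‖‖x‖⁻¹ • x - ‖y‖⁻¹ • y‖ ^ 2)
  linarith

/-! ### The descent inequality -/

theorem eq_of_mem_zer {α β μ : ℝ} (hαβ : 0 < α + β) (hμ : IsPhiConstant X μ)
    {A : X → Set (StrongDual ℝ X)} {B : X → StrongDual ℝ X} (hA : IsAlphaMonotone α A)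
    (hB : IsAlphaMonotone β (fun x => {B x})) {p q : X} (hp : p ∈ zer A B) (hq : q ∈ zer A B) :
    p = q := by
  obtain ⟨u, hu, hup⟩ := hp
  obtain ⟨v, hv, hvq⟩ := hq
  have h1 := hA p q u v hu hv
  have h2 := hB p q (B p) (B q) rfl rfl
  have h3 : (u - v) (p - q) + (B p - B q) (p - q) = 0 := by
    rw [← add_apply, show u - v + (B p - B q) = (u + B p) - (v + B q) by abel, hup, hvq]
    simp
  have h4 := phi_add_phi_swap p q
  have h5 := phi_nonneg q p
  have h6 := phi_nonneg p q
  have h7 : phi p q = 0 := by nlinarith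
  have h8 := hμ.sq_norm_sub_le p q
  rw [h7, mul_zero] at h8
  exact sub_eq_zero.mp (norm_eq_zero.mp (pow_eq_zero_iff two_ne_zero |>.mp
    (le_antisymm h8 (sq_nonneg _))))

theorem two_mul_abs_sub_apply_le {μ r κ : ℝ} {L : ℝ≥0} {B : X → StrongDual ℝ X}
    (hB : LipschitzWith L B) (hμ : IsPhiConstant X μ) (hr : 0 ≤ r) (hκ : r * L * μ ≤ κ)
    (x y w z : X) : |2 * r * (B x - B y) (w - z)| ≤ κ * (phi x y + phi w z) := by
  have h1 : |(B x - B y) (w - z)| ≤ L * ‖x - y‖ * ‖w - z‖ :=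
    ((B x - B y).le_opNorm _).trans
      (mul_le_mul_of_nonneg_right (hB.norm_sub_le x y) (norm_nonneg _))
  have h2 := hμ.sq_norm_sub_le x y
  have h3 := hμ.sq_norm_sub_le w z
  have h4 : 2 * (‖x - y‖ * ‖w - z‖) ≤ μ * (phi x y + phi w z) := by
    linarith [two_mul_le_add_sq ‖x - y‖ ‖w - z‖]
  have h5 := phi_nonneg x y
  have h6 := phi_nonneg w z
  rw [abs_mul, abs_of_nonneg (by positivity : 0 ≤ 2 * r)]
  calc 2 * r * |(B x - B y) (w - z)| ≤ 2 * r * (L * ‖x - y‖ * ‖w - z‖) := by gcongr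
    _ = r * L * (2 * (‖x - y‖ * ‖w - z‖)) := by ring
    _ ≤ r * L * (μ * (phi x y + phi w z)) := by gcongr
    _ = r * L * μ * (phi x y + phi w z) := by ring
    _ ≤ κ * (phi x y + phi w z) := by gcongr

/-- The consequence of monotonicity of `A` and `B` for one step of the method. -/
theorem IsStep.descent {α β r s : ℝ} (hαβ : 0 ≤ α + β) (hr : 0 ≤ r)
    {A : X → Set (StrongDual ℝ X)} {B : X → StrongDual ℝ X} (hA : IsAlphaMonotone α A)
    (hB : IsAlphaMonotone β (fun x => {B x})) {x xprev xnext p : X}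
    (h : IsStep A B r s x xprev xnext) (hp : p ∈ zer A B) :
    (1 + r * (α + β)) * phi p xnext + phi xnext x + 2 * r * (B xnext - B x) (p - xnext) ≤
      phi p x + 2 * s * (B x - B xprev) (p - x) - 2 * s * (B x - B xprev) (xnext - x) := by
  obtain ⟨z, hz, u, hu, hzu⟩ := h
  obtain ⟨v, hv, hvp⟩ := hp
  have h1 := hA xnext p u v hu hv
  have h2 := hB xnext p (B xnext) (B p) rfl rfl
  have h3 := phi_add_phi_swap xnext p
  have h4 : 0 ≤ phi xnext p := phi_nonneg _ _
  have h5 := two_mul_J_sub_apply p x xnext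
  have h6 : (α + β) * (J xnext - J p) (xnext - p) ≤ u (xnext - p) + B xnext (xnext - p) := by
    have : v (xnext - p) + B p (xnext - p) = 0 := by
      rw [← add_apply, hvp, zero_apply]
    simp only [sub_apply] at h1 h2 ⊢
    linarith
  have h7 : r * u (xnext - p) =
      (J x - J xnext) (xnext - p) - r * B x (xnext - p) - s * (B x - B xprev) (xnext - p) := by
    have h8 : r • u = (J x - J xnext) - r • B x - s • (B x - B xprev) := by
      rw [eq_sub_of_add_eq' (hzu.symm.trans hz)]
      abel
    simpa using congrArg (fun f : StrongDual ℝ X => f (xnext - p)) h8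
  have h9 := mul_le_mul_of_nonneg_left h6 hr
  have h10 : 0 ≤ r * (α + β) * phi xnext p := by positivity
  have h11 : r * ((α + β) * (J xnext - J p) (xnext - p)) =
      r * (α + β) * (phi xnext p + phi p xnext) / 2 := by rw [h3]; ring
  rw [h11] at h9
  simp only [sub_apply, map_sub] at h5 h7 h9 ⊢
  linarith

/-- The Lyapunov quantity `a + b` attached to two consecutive iterates `y`, `x`, the step size `r`
between them, and the zero `p`: the sum of `φ(p, x) / 2` and
`φ(p, x) / 2 + 2 r ⟨B x - B y, p - x⟩ + φ(x, y) / 2`. -/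
noncomputable def lyapunov (B : X → StrongDual ℝ X) (p : X) (r : ℝ) (x y : X) : ℝ :=
  1 / 2 * phi p x + (1 / 2 * phi p x + 2 * r * (B x - B y) (p - x) + 1 / 2 * phi x y)

theorem half_phi_le_lyapunov {μ r : ℝ} {L : ℝ≥0} {B : X → StrongDual ℝ X}
    (hB : LipschitzWith L B) (hμ : IsPhiConstant X μ) (hr : 0 ≤ r) (hκ : r * L * μ ≤ 1 / 2)
    (p x y : X) : 1 / 2 * phi p x ≤ lyapunov B p r x y := by
  have h := (abs_le.mp (two_mul_abs_sub_apply_le hB hμ hr hκ x y p x)).1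
  unfold lyapunov
  linarith

/-- One step contracts the Lyapunov quantity. The factor `1 + δ` is admissible because
`a + b ≤ 3 φ(p, x) / 2 + φ(x, y)`, while the descent inequality leaves a surplus of
`ε (α + β) φ(p, x) + ε φ(x, y)`. -/
theorem IsStep.lyapunov_le {α β ε δ μ r s : ℝ} {L : ℝ≥0} (hε : 0 < ε) (hαβ : 0 ≤ α + β)
    (hδ : 0 ≤ δ) (hδ₁ : 3 / 2 * δ ≤ ε * (α + β)) (hδ₂ : δ ≤ ε)
    {A : X → Set (StrongDual ℝ X)} {B : X → StrongDual ℝ X} (hA : IsAlphaMonotone α A)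
    (hB : IsAlphaMonotone β (fun x => {B x})) (hL : LipschitzWith L B) (hμ : IsPhiConstant X μ)
    (hr : ε ≤ r) (hs : ε ≤ s) (hrκ : r * L * μ ≤ 1 / 2 - ε) (hsκ : s * L * μ ≤ 1 / 2 - ε)
    {x xprev xnext p : X} (h : IsStep A B r s x xprev xnext) (hp : p ∈ zer A B) :
    (1 + δ) * lyapunov B p r xnext x ≤ lyapunov B p s x xprev := by
  have h1 := h.descent hαβ (hε.le.trans hr) hA hB hp
  have h2 := (abs_le.mp
    (two_mul_abs_sub_apply_le hL hμ (hε.le.trans hs) hsκ x xprev xnext x)).1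
  have h3 := (abs_le.mp (two_mul_abs_sub_apply_le hL hμ (hε.le.trans hr)
    (hrκ.trans (by linarith : 1 / 2 - ε ≤ 1 / 2)) xnext x p xnext)).2
  have hP := phi_nonneg p xnext
  have hQ := phi_nonneg xnext x
  have hQ' := mul_nonneg hε.le (phi_nonneg x xprev)
  have h4 : ε * (α + β) * phi p xnext ≤ r * (α + β) * phi p xnext := by gcongr
  have h5 := mul_le_mul_of_nonneg_right hδ₁ hP
  have h6 := mul_le_mul_of_nonneg_right hδ₂ hQ
  have h7 := mul_le_mul_of_nonneg_left h3 hδ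
  unfold lyapunov
  linarith

/-! ### Rates of convergence -/

theorem convergesRLinearly_of_sq_le {E : Type*} [NormedAddCommGroup E] {x : ℕ → E} {p : E}
    {θ K : ℝ} (hθ : 1 < θ)
    (h : ∀ n : ℕ, ‖x (n + 1) - p‖ ^ 2 ≤ K / θ ^ n) : ConvergesRLinearly x p := by
  have hθ0 : 0 < θ := by linarith
  have hs : 1 < √θ := by rwa [Real.lt_sqrt zero_le_one, one_pow]
  refine ⟨‖x 0 - p‖ + √K * √θ, (√θ)⁻¹, by positivity, inv_lt_one_of_one_lt₀ hs, fun n => ?_⟩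
  cases n with
  | zero =>
    rw [pow_zero, mul_one]
    exact le_add_of_nonneg_right (by positivity)
  | succ n =>
    have h1 : ‖x (n + 1) - p‖ ≤ √K / √θ ^ n := by
      have h2 := Real.le_sqrt_of_sq_le (h n)
      have h3 : θ ^ n = (√θ ^ n) ^ 2 := by rw [pow_right_comm, Real.sq_sqrt hθ0.le]
      rwa [h3, Real.sqrt_div' _ (by positivity), Real.sqrt_sq (by positivity)] at h2
    have h3 : √K / √θ ^ n = √K * √θ * (√θ)⁻¹ ^ (n + 1) := by
      rw [inv_pow, pow_succ]
      field_simp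
    rw [add_mul, ← h3]
    exact h1.trans (le_add_of_nonneg_left (by positivity))

theorem ConvergesRLinearly.tendsto {E : Type*} [NormedAddCommGroup E] {x : ℕ → E} {p : E}
    (h : ConvergesRLinearly x p) :
    Tendsto x atTop (𝓝 p) := by
  obtain ⟨C, q, hq0, hq1, h⟩ := h
  rw [tendsto_iff_norm_sub_tendsto_zero]
  refine squeeze_zero (fun n => norm_nonneg _) h ?_
  simpa using (tendsto_pow_atTop_nhds_zero_of_lt_one hq0 hq1).const_mul C

end FRB

theorem mainTheorem1 (α β ε : ℝ) (hε : 0 < ε) (hεαβ : ε < α + β) :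
    ∃ θ : ℝ, 1 < θ ∧
      ∀ (X : Type*) [NormedAddCommGroup X] [NormedSpace ℝ X] [CompleteSpace X],
        FRB.IsTwoUniformlyConvex X → FRB.IsUniformlySmooth X →
        (∃ μ : ℝ, FRB.IsPhiConstant X μ) ∧
        ∀ μ : ℝ, FRB.IsPhiConstant X μ →
        ∀ (L : ℝ≥0) (A : X → Set (StrongDual ℝ X)) (B : X → StrongDual ℝ X),
          0 < L → FRB.IsMaximallyMonotone A → FRB.IsAlphaMonotone α A →
          FRB.IsAlphaMonotone β (fun x => {B x}) → LipschitzWith L B →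
          (FRB.zer A B).Nonempty →
        ∀ (lamPrev : ℝ) (lam : ℕ → ℝ) (xPrev : X) (x : ℕ → X),
          (∀ n : ℕ, lam n ∈ Set.Icc ε ((1 - 2 * ε) / (2 * μ * (L : ℝ)))) →
          FRB.IsIteration A B lamPrev lam xPrev x →
          ∃ p : X, FRB.zer A B = {p} ∧
            Tendsto x atTop (𝓝 p) ∧
            FRB.ConvergesRLinearly x p ∧
            ∀ n : ℕ, ‖x (n + 1) - p‖ ^ 2 ≤ 2 * μ / θ ^ n *
              (1 / 2 * FRB.phi p (x 1) +
                (1 / 2 * FRB.phi p (x 1) + 2 * lam 0 * (B (x 1) - B (x 0)) (p - x 1) +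
                  1 / 2 * FRB.phi (x 1) (x 0))) := by
  have hαβ : 0 < α + β := hε.trans hεαβ
  set δ : ℝ := min (2 / 3 * (ε * (α + β))) ε
  have hδ : 0 < δ := lt_min (by positivity) hε
  have hδ₁ : 3 / 2 * δ ≤ ε * (α + β) := by
    linarith [min_le_left (2 / 3 * (ε * (α + β))) ε]
  have hδ₂ : δ ≤ ε := min_le_right _ _
  refine ⟨1 + δ, by linarith, ?_⟩
  intro X _ _ _ hconv _
  refine ⟨FRB.exists_isPhiConstant hconv, ?_⟩
  intro μ hμ L A B hL0 _ hA hB hL hne lamPrev lam xPrev x hlam hx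
  obtain ⟨p, hp⟩ := hne
  have hμ0 : 0 < μ := by linarith [hμ.1]
  have hL0' : (0 : ℝ) < L := hL0
  have hκ (n : ℕ) : lam n * L * μ ≤ 1 / 2 - ε := by
    have h := (hlam n).2
    rw [le_div_iff₀ (by positivity)] at h
    linarith
  have hdecay (n : ℕ) : FRB.lyapunov B p (lam n) (x (n + 1)) (x n) ≤
      FRB.lyapunov B p (lam 0) (x 1) (x 0) / (1 + δ) ^ n := by
    induction n with
    | zero => simp
    | succ n ih =>
      have h := (hx.2 n).lyapunov_le hε hαβ.le hδ.le hδ₁ hδ₂ hA hB hL hμ (hlam (n + 1)).1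
        (hlam n).1 (hκ (n + 1)) (hκ n) hp
      rw [pow_succ, ← div_div, le_div_iff₀ (by linarith), mul_comm]
      exact h.trans ih
  have hrate (n : ℕ) : ‖x (n + 1) - p‖ ^ 2 ≤
      2 * μ / (1 + δ) ^ n * FRB.lyapunov B p (lam 0) (x 1) (x 0) := by
    have h1 := FRB.half_phi_le_lyapunov hL hμ (hε.le.trans (hlam n).1)
      ((hκ n).trans (by linarith)) p (x (n + 1)) (x n)
    have h2 := hμ.sq_norm_sub_le p (x (n + 1))
    have h3 := mul_le_mul_of_nonneg_left (h1.trans (hdecay n)) (by positivity : 0 ≤ 2 * μ)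
    rw [norm_sub_rev]
    calc _ ≤ _ := h2
      _ = 2 * μ * (1 / 2 * FRB.phi p (x (n + 1))) := by ring
      _ ≤ _ := h3
      _ = _ := by ring
  have hR : FRB.ConvergesRLinearly x p :=
    FRB.convergesRLinearly_of_sq_le (θ := 1 + δ) (by linarith)
      (fun n => (hrate n).trans_eq (div_mul_eq_mul_div _ _ _))
  exact ⟨p, Set.eq_singleton_iff_unique_mem.mpr
    ⟨hp, fun q hq => FRB.eq_of_mem_zer hαβ hμ hA hB hq hp⟩, hR.tendsto, hR, hrate⟩
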